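/- **Conventions.** All C*-algebras, *-morphisms and representations are unital; inner products are linear in the second variable. A seminorm $N$ defined on a subspace $\mathrm{dom}(N)$ of a normed space is extended by $N=\infty$ off $\mathrm{dom}(N)$. For elements $a$ of a C*-algebra $A$, $\Re a=\frac{a+a^*}2$, $\Im a=\frac{a-a^*}{2i}$; $\mathfrak{sa}(A)$ is the space of self-adjoint elements and $\mathscr S(A)$ the state space. For a distance function $d$ on a set, $\mathrm{H}_d(S\to T)=\sup_{x\in S}\inf_{y\in T}d(x,y)$ and $\mathrm{Haus}_d(S,T)=\max\{\mathrm H_d(S\to T),\mathrm H_d(T\to S)\}$. Constants $F\ge 1$, $K\ge 0$, $G\ge 1$, $H\ge 2$ are fixed throughout. **Quantum compact metric spaces.** An $(F,K)$-quantum compact metric space $(A,L)$ is a unital C*-algebra $A$ with a seminorm $L$ on a dense subspace of $\mathfrak{sa}(A)$ such that $L(1)=0$; $\mathrm{mk}_L(\varphi,\psi)=\sup\{|\varphi(a)-\psi(a)|:L(a)\le 1\}$ is a metric on $\mathscr S(A)$ inducing the weak* topology; $\max\{L(\Re(ab)),L(\Im(ab))\}\le F(L(a)\|b\|+\|a\|L(b))+K\,L(a)L(b)$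 for $a,b\in\mathrm{dom}(L)$; and $\{a : L(a)\le1\}$ is closed. **Metric spectral triples.** A spectral triple $(A,\mathscr H,D)$ is a unital C*-algebra $A$ with a unital *-representation on a Hilbert space $\mathscr H$ and a self-adjoint operator $D$ on a dense domain of $\mathscr H$ such that $D+i$ has a compact inverse and $\mathrm{dom}(L_D)=\{a\in\mathfrak{sa}(A): a\,\mathrm{dom}(D)\subseteq\mathrm{dom}(D),\ [D,a]\text{ bounded}\}$ is dense in $\mathfrak{sa}(A)$. With $L_D(a)=\|[D,a]\|$ on $\mathrm{dom}(L_D)$, the triple is metric if $(A,L_D)$ is a $(1,0)$-quantum compact metric space. The spectrum $\mathrm{Sp}(D)\subseteq\mathbb C$ is the complement of the set of $\lambda\in\mathbb C$ such that $D-\lambda$ has a bounded inverse defined on $\mathscr H$. Write $\mathrm{DN}_D(\xi)=\|\xi\|+\|D\xi\|$ for $\xi\in\mathrm{dom}(D)$, and $U_D^t=\exp(itD)$. **Metrical C*-correspondences.** An $(F,K,G,H)$-metrical C*-correspondence $(M,\mathrm{TN},A,L_A,B,L_B)$ consists of $(F,K)$-quantum compact metric spaces $(A,L_A)$, $(B,L_B)$,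 a right Hilbert C*-module $M$ over $B$ with a unital *-morphism from $A$ to the adjoinable operators of $M$, and a norm $\mathrm{TN}$ on a dense complex subspace of $M$ with $\mathrm{TN}(\omega)\ge\|\omega\|_M$; $\{\mathrm{TN}\le1\}$ compact in $M$; $\mathrm{TN}(a\omega)\le G(\|a\|+L_A(a))\mathrm{TN}(\omega)$; and $\max\{L_B(\Re\langle\omega,\eta\rangle),L_B(\Im\langle\omega,\eta\rangle)\}\le H\,\mathrm{TN}(\omega)\mathrm{TN}(\eta)$, for all $a\in\mathrm{dom}(L_A)$, $\omega,\eta\in\mathrm{dom}(\mathrm{TN})$. A metric spectral triple yields $\mathrm{mcc}(A,\mathscr H,D)=(\mathscr H,\mathrm{DN}_D,A,L_D,\mathbb C,0)$. **Tunnels.** A modular quantum isometry $(\Pi,\pi,\theta)$ from $(M_1,\mathrm{TN}_1,A_1,L_{A_1},B_1,L_{B_1})$ to $(M_2,\mathrm{TN}_2,A_2,L_{A_2},B_2,L_{B_2})$ consists of a continuous linear map $\Pi:M_1\to M_2$ and unital *-morphisms $\pi:A_1\to A_2$, $\theta:B_1\to B_2$ with $\Pi(a\omega)=\pi(a)\Pi(\omega)$,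 $\Pi(\omega b)=\Pi(\omega)\theta(b)$, $\theta(\langle\omega,\eta\rangle)=\langle\Pi\omega,\Pi\eta\rangle$, mapping $\mathrm{dom}(L_{A_1})$, $\mathrm{dom}(L_{B_1})$, $\mathrm{dom}(\mathrm{TN}_1)$ into $\mathrm{dom}(L_{A_2})$, $\mathrm{dom}(L_{B_2})$, $\mathrm{dom}(\mathrm{TN}_2)$, and such that on these latter domains $L_{A_2}$, $L_{B_2}$, $\mathrm{TN}_2$ are the quotients (infimum over preimages) of $L_{A_1}$, $L_{B_1}$, $\mathrm{TN}_1$ under $\pi,\theta,\Pi$. A tunnel $\tau$ from $(A_1,\mathscr H_1,D_1)$ to $(A_2,\mathscr H_2,D_2)$ is an $(F,K,G,H)$-metrical C*-correspondence $(P,\mathrm{TN},\mathfrak D,L_{\mathfrak D},\mathfrak E,L_{\mathfrak E})$ with modular quantum isometries $(\Pi_j,\pi_j,\theta_j)$ from it to $\mathrm{mcc}(A_j,\mathscr H_j,D_j)$, $j=1,2$. Its extent $\chi(\tau)$ is the maximum over $j\in\{1,2\}$ of $\mathrm{Haus}_{\mathrm{mk}_{L_{\mathfrak D}}}(\{\varphi\circ\pi_j:\varphi\in\mathscr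 S(A_j)\},\mathscr S(\mathfrak D))$ and $\mathrm{Haus}_{\mathrm{mk}_{L_{\mathfrak E}}}(\{\psi\circ\theta_j:\psi\in\mathscr S(\mathbb C)\},\mathscr S(\mathfrak E))$. **Spectral propinquity.** For $\varepsilon>0$, an $\varepsilon$-iso-iso is a pair of maps $\varsigma_1,\varsigma_2:[0,\infty)\to[0,\infty)$ with $\varsigma_1(0)=\varsigma_2(0)=0$ and $\big||\varsigma_j(x)+\varsigma_j(y)-z|-|x+y-\varsigma_k(z)|\big|<\varepsilon$ for all $x,y,z\in[0,\frac1\varepsilon]$ and $\{j,k\}=\{1,2\}$. For a tunnel $\tau$ as above and an $\varepsilon$-iso-iso, the $\varepsilon$-reach is $$\rho(\tau,\varsigma_1,\varsigma_2|\varepsilon)=\max_{\{j,k\}=\{1,2\}}\ \sup_{\mathrm{DN}_{D_j}(\xi)\le1}\ \inf_{\mathrm{DN}_{D_k}(\eta)\le1}\ \sup_{0\le t\le 1/\varepsilon}\ \sup_{\mathrm{TN}(\omega)\le1}\left|\langle U_{D_j}^{-t}\xi,\Pi_j(\omega)\rangle-\langle U_{D_k}^{-\varsigma_j(t)}\eta,\Pi_k(\omega)\rangle\right|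 .$$ The spectral propinquity $\Lambda^{\mathrm{spec}}$ between the two triples is the infimum of the set consisting of $\frac{\sqrt2}2$ and of all $\varepsilon>0$ for which there are a tunnel $\tau$ and an $\varepsilon$-iso-iso $(\varsigma_1,\varsigma_2)$ with $\max\{\chi(\tau),\rho(\tau,\varsigma_1,\varsigma_2|\varepsilon)\}<\varepsilon$. **Theorem.** Let $(A_n,\mathscr H_n,D_n)_{n\in\mathbb N}$ be a sequence of metric spectral triples with $\mathscr H_n\ne\{0\}$ for every $n$, and let $(A_\infty,\mathscr H_\infty,D_\infty)$ be a metric spectral triple such that $\lim_{n\to\infty}\Lambda^{\mathrm{spec}}\big((A_n,\mathscr H_n,D_n),(A_\infty,\mathscr H_\infty,D_\infty)\big)=0$. Then $$\mathrm{Sp}(D_\infty)=\Big\{\lambda\in\mathbb R:\ \exists(\lambda_n)_{n\in\mathbb N}\in\mathbb R^{\mathbb N},\ \lambda_n\in\mathrm{Sp}(D_n)\text{ for all }n\in\mathbb N\text{ and }\lambda=\lim_{n\to\infty}\lambda_n\Big\}.$$ -/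

import Mathlib

open Filter Topology
open scoped ENNReal NNReal InnerProductSpace ComplexOrder ComplexStarModule

universe u

noncomputable section

namespace SpectralPropinquity

/-! ### Extended seminorms, states, quantum compact metric spaces

A seminorm defined on a subspace of `E` is encoded by its extension to `E` which takes the value
`∞` off that subspace; its domain is then the set of points at which it is finite. -/

/-- `N : E → [0, ∞]` is (the extension by `∞` of) a seminorm defined on a subspace of `E`. -/
structure IsExtSeminorm (𝕜 : Type*) {E : Type*} [NormedField 𝕜] [AddCommGroup E] [Module 𝕜 E]
    (N : E → ℝ≥0∞) : Prop where
  add_le : ∀ x y : E, N (x + y) ≤ N x + N y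
  smul : ∀ (c : 𝕜) (x : E), N (c • x) = ‖c‖ₑ * N x

/-- The domain of an extended seminorm. -/
def dom {E : Type*} (N : E → ℝ≥0∞) : Set E := {x | N x < ∞}

/-- The state space of a unital C⋆-algebra, as a subset of the dual with the weak⋆ topology. -/
def stateSpace (A : Type*) [CStarAlgebra A] : Set (WeakDual ℂ A) :=
  {φ | φ 1 = 1 ∧ ∀ a : A, 0 ≤ φ (star a * a)}

/-- The Monge–Kantorovich distance between two states. -/
def kantorovich {A : Type*} [CStarAlgebra A] (L : selfAdjoint A → ℝ≥0∞)
    (φ ψ : stateSpace A) : ℝ≥0∞ :=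
  ⨆ (a : selfAdjoint A) (_ : L a ≤ 1), ‖φ.1 (a : A) - ψ.1 (a : A)‖ₑ

/-- `(A, L)` is an `(F, K)`-quantum compact metric space. The three fields `finite`, `separating`
and `nhds_basis` say that the Monge–Kantorovich distance (which is always symmetric, vanishes on
the diagonal and satisfies the triangle inequality) is a metric on the state space and induces
the weak⋆ topology. -/
structure IsQCMS (F K : ℝ≥0) {A : Type*} [CStarAlgebra A] (L : selfAdjoint A → ℝ≥0∞) :
    Prop where
  seminorm : IsExtSeminorm ℝ L
  dense : Dense (dom L)
  one : L 1 = 0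
  finite : ∀ φ ψ : stateSpace A, kantorovich L φ ψ < ∞
  separating : ∀ φ ψ : stateSpace A, kantorovich L φ ψ = 0 → φ = ψ
  nhds_basis : ∀ φ : stateSpace A,
    (𝓝 φ).HasBasis (fun ε : ℝ => 0 < ε) (fun ε => {ψ | kantorovich L φ ψ < ENNReal.ofReal ε})
  leibniz : ∀ a ∈ dom L, ∀ b ∈ dom L,
    max (L (ℜ ((a : A) * (b : A)))) (L (ℑ ((a : A) * (b : A)))) ≤
      F * (L a * ‖(b : A)‖ₑ + ‖(a : A)‖ₑ * L b) + K * L a * L b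
  closed : IsClosed {a : selfAdjoint A | L a ≤ 1}

/-! ### Metrical C⋆-correspondences -/

set_option linter.checkUnivs false in
/-- An `A`-`B` C⋆-correspondence `M` (all data unital), together with the functions `DN`, `LA`,
`LB` which are to become its D-norm and Lipschitz seminorms. The right action of `B` is an action
of the opposite algebra. The C⋆-algebra `A` acts by adjoinable operators: the adjoint of the
action of `a` is the action of `star a`. -/
structure Correspondence.{u₁, v₁} where
  Mod : Type u₁
  A : Type u₁
  B : Type v₁
  [cstarA : CStarAlgebra A]
  [cstarB : CStarAlgebra B]
  [normedMod : NormedAddCommGroup Mod]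
  [spaceMod : NormedSpace ℂ Mod]
  [completeMod : CompleteSpace Mod]
  [rightMod : Module (MulOpposite B) Mod]
  /-- The `B`-valued inner product. -/
  ip : Mod → Mod → B
  ip_add_right : ∀ x y z : Mod, ip x (y + z) = ip x y + ip x z
  ip_smul_right : ∀ (c : ℂ) (x y : Mod), ip x (c • y) = c • ip x y
  ip_op_smul_right : ∀ (b : B) (x y : Mod), ip x (MulOpposite.op b • y) = ip x y * b
  ip_star : ∀ x y : Mod, ip x y = star (ip y x)
  /-- Positivity in the C⋆-algebra `B`. -/
  ip_self_nonneg : ∀ x : Mod, ∃ b : B, ip x x = star b * b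
  ip_self_eq_zero : ∀ x : Mod, ip x x = 0 ↔ x = 0
  norm_eq : ∀ x : Mod, ‖x‖ = √‖ip x x‖
  /-- The left action of `A`. -/
  act : A →ₐ[ℂ] (Mod →L[ℂ] Mod)
  act_op_smul : ∀ (a : A) (b : B) (x : Mod),
    act a (MulOpposite.op b • x) = MulOpposite.op b • act a x
  act_adjoint : ∀ (a : A) (x y : Mod), ip (act a x) y = ip x (act (star a) y)
  /-- The D-norm. -/
  DN : Mod → ℝ≥0∞
  /-- The Lipschitz seminorm of `A`. -/
  LA : selfAdjoint A → ℝ≥0∞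
  /-- The Lipschitz seminorm of `B`. -/
  LB : selfAdjoint B → ℝ≥0∞

attribute [instance] Correspondence.cstarA Correspondence.cstarB Correspondence.normedMod
  Correspondence.spaceMod Correspondence.completeMod Correspondence.rightMod

/-- `M` is an `(F, K, G, H)`-metrical C⋆-correspondence. -/
structure Correspondence.IsMetrical (F K G H : ℝ≥0) (M : Correspondence) : Prop where
  qcmsA : IsQCMS F K M.LA
  qcmsB : IsQCMS F K M.LB
  seminorm : IsExtSeminorm ℂ M.DN
  dense : Dense (dom M.DN)
  norm_le : ∀ x : M.Mod, ‖x‖ₑ ≤ M.DN x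
  compact : IsCompact {x : M.Mod | M.DN x ≤ 1}
  modular_leibniz : ∀ a ∈ dom M.LA, ∀ x ∈ dom M.DN,
    M.DN (M.act (a : M.A) x) ≤ G * (‖(a : M.A)‖ₑ + M.LA a) * M.DN x
  inner_leibniz : ∀ x ∈ dom M.DN, ∀ y ∈ dom M.DN,
    max (M.LB (ℜ (M.ip x y))) (M.LB (ℑ (M.ip x y))) ≤ H * M.DN x * M.DN y

/-- A modular quantum isometry `(Π, π, θ)` from `M` to `N`: a Lipschitz morphism for which the
D-norm and the Lipschitz seminorms of `N` are the quotients of those of `M`. -/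
structure ModularQuantumIsometry (M N : Correspondence) where
  /-- The map between modules. -/
  onMod : M.Mod →L[ℂ] N.Mod
  /-- The map between the left algebras. -/
  onA : M.A →⋆ₐ[ℂ] N.A
  /-- The map between the right algebras. -/
  onB : M.B →⋆ₐ[ℂ] N.B
  map_act : ∀ (a : M.A) (x : M.Mod), onMod (M.act a x) = N.act (onA a) (onMod x)
  map_op_smul : ∀ (b : M.B) (x : M.Mod),
    onMod (MulOpposite.op b • x) = MulOpposite.op (onB b) • onMod x
  map_ip : ∀ x y : M.Mod, onB (M.ip x y) = N.ip (onMod x) (onMod y)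
  map_dom_LA : ∀ (d : selfAdjoint M.A) (a : selfAdjoint N.A),
    onA (d : M.A) = (a : N.A) → d ∈ dom M.LA → a ∈ dom N.LA
  map_dom_LB : ∀ (d : selfAdjoint M.B) (b : selfAdjoint N.B),
    onB (d : M.B) = (b : N.B) → d ∈ dom M.LB → b ∈ dom N.LB
  map_dom_DN : ∀ x ∈ dom M.DN, onMod x ∈ dom N.DN
  quotient_LA : ∀ a ∈ dom N.LA,
    N.LA a = ⨅ (d : selfAdjoint M.A) (_ : onA (d : M.A) = (a : N.A)), M.LA d
  quotient_LB : ∀ b ∈ dom N.LB,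
    N.LB b = ⨅ (d : selfAdjoint M.B) (_ : onB (d : M.B) = (b : N.B)), M.LB d
  quotient_DN : ∀ y ∈ dom N.DN, N.DN y = ⨅ (x : M.Mod) (_ : onMod x = y), M.DN x

/-- A metrical tunnel between two correspondences, whose middle term is an
`(F, K, G, H)`-metrical C⋆-correspondence. -/
structure Tunnel.{u₁, v₁, w₁} (F K G H : ℝ≥0) (M₁ M₂ : Correspondence.{u₁, v₁}) where
  mid : Correspondence.{u₁, w₁}
  metrical : mid.IsMetrical F K G H
  left : ModularQuantumIsometry mid M₁
  right : ModularQuantumIsometry mid M₂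

/-- The reversed tunnel. -/
def Tunnel.symm {F K G H : ℝ≥0} {M₁ M₂ : Correspondence} (τ : Tunnel F K G H M₁ M₂) :
    Tunnel F K G H M₂ M₁ where
  mid := τ.mid
  metrical := τ.metrical
  left := τ.right
  right := τ.left

/-! ### Hausdorff distance, extent -/

/-- `sup_{x ∈ S} inf_{y ∈ T} d x y`. -/
def hausdorffTo {E : Type*} (d : E → E → ℝ≥0∞) (S T : Set E) : ℝ≥0∞ :=
  ⨆ x ∈ S, ⨅ y ∈ T, d x y

/-- The Hausdorff distance between sets, for a given (extended) distance function. -/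
def hausdorff {E : Type*} (d : E → E → ℝ≥0∞) (S T : Set E) : ℝ≥0∞ :=
  max (hausdorffTo d S T) (hausdorffTo d T S)

/-- `{φ ∘ π : φ a state of B}`, as a set of states of `A`. -/
def pullbackStates {A B : Type*} [CStarAlgebra A] [CStarAlgebra B] (π : A →⋆ₐ[ℂ] B) :
    Set (stateSpace A) :=
  {ψ | ∃ φ : stateSpace B, ∀ a : A, ψ.1 a = φ.1 (π a)}

/-- The contribution to the extent of one leg of a tunnel. -/
def ModularQuantumIsometry.extent {M N : Correspondence} (Q : ModularQuantumIsometry M N) :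
    ℝ≥0∞ :=
  max (hausdorff (kantorovich M.LA) (pullbackStates Q.onA) Set.univ)
    (hausdorff (kantorovich M.LB) (pullbackStates Q.onB) Set.univ)

/-- The extent of a tunnel. -/
def Tunnel.extent {F K G H : ℝ≥0} {M₁ M₂ : Correspondence} (τ : Tunnel F K G H M₁ M₂) : ℝ≥0∞ :=
  max τ.left.extent τ.right.extent

/-! ### Unbounded operators and spectral triples -/

section Unbounded

variable {X : Type*} [NormedAddCommGroup X] [InnerProductSpace ℂ X]

/-- The bounded operator `R` is the inverse of `D - z`. -/
def IsResolvent (D : X →ₗ.[ℂ] X) (z : ℂ) (R : X →L[ℂ] X) : Prop :=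
  (∀ x : X, ∃ h : R x ∈ D.domain, D ⟨R x, h⟩ - z • R x = x) ∧
    ∀ x : D.domain, R (D x - z • (x : X)) = x

/-- The spectrum of a possibly unbounded operator: the complement of the resolvent set. -/
def spectrum (D : X →ₗ.[ℂ] X) : Set ℂ := {z | ∃ R : X →L[ℂ] X, IsResolvent D z R}ᶜ

/-- The eigenspace `{x ∈ dom D : D x = r x}`. -/
def eigenspace (D : X →ₗ.[ℂ] X) (r : ℝ) : Submodule ℂ X :=
  (LinearMap.ker (D.toFun - (r : ℂ) • D.domain.subtype)).map D.domain.subtype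

/-- `exp (i t D) x`, for `D` a self-adjoint operator with compact resolvent, by the spectral
decomposition of `D`: the sum over all real `r` of `exp (i t r) • P r x`, where `P r` is the
orthogonal projection onto the eigenspace of `r` (which is closed when `D` is self-adjoint, and is
zero for all but countably many `r`). -/
def expI [CompleteSpace X] (D : X →ₗ.[ℂ] X) (t : ℝ) (x : X) : X :=
  ∑' r : ℝ, Complex.exp (Complex.I * t * r) • (eigenspace D r).topologicalClosure.starProjection x

/-- The graph norm `‖x‖ + ‖D x‖` on `dom D`, extended by `∞`. -/
def graphNorm (D : X →ₗ.[ℂ] X) (x : X) : ℝ≥0∞ :=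
  ⨅ h : x ∈ D.domain, ‖x‖ₑ + ‖D ⟨x, h⟩‖ₑ

/-- The operator norm of the commutator `[D, a]` on `dom D` if `a` maps `dom D` into itself and
`[D, a]` is bounded, and `∞` otherwise. -/
def commutatorNorm (D : X →ₗ.[ℂ] X) (a : X →L[ℂ] X) : ℝ≥0∞ :=
  ⨅ (C : ℝ≥0) (_ : ∀ x : D.domain, ∃ h : a x ∈ D.domain,
    ‖D ⟨a x, h⟩ - a (D x)‖ ≤ C * ‖(x : X)‖), (C : ℝ≥0∞)

end Unbounded

/-- A spectral triple `(A, X, D)`. -/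
structure SpectralTriple (A X : Type*) [CStarAlgebra A] [NormedAddCommGroup X]
    [InnerProductSpace ℂ X] [CompleteSpace X] where
  /-- The unital ⋆-representation of `A` on `X`. -/
  rep : A →⋆ₐ[ℂ] (X →L[ℂ] X)
  /-- The Dirac operator. -/
  D : X →ₗ.[ℂ] X
  dense_domain : Dense (D.domain : Set X)
  selfAdjoint_D : IsSelfAdjoint D
  compact_resolvent : ∃ R : X →L[ℂ] X, IsResolvent D (-Complex.I) R ∧ IsCompactOperator R
  dense_lipschitz : Dense (dom fun a : selfAdjoint A => commutatorNorm D (rep (a : A)))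

namespace SpectralTriple

variable {A X : Type*} [CStarAlgebra A] [NormedAddCommGroup X] [InnerProductSpace ℂ X]
  [CompleteSpace X]

/-- The seminorm `a ↦ ‖[D, a]‖` on self-adjoint elements. -/
def lip (T : SpectralTriple A X) (a : selfAdjoint A) : ℝ≥0∞ := commutatorNorm T.D (T.rep (a : A))

/-- A spectral triple is metric when `(A, ‖[D, ·]‖)` is a quantum compact metric space. -/
def IsMetric (T : SpectralTriple A X) : Prop := IsQCMS 1 0 T.lip

end SpectralTriple

/-- The C⋆-correspondence of a spectral triple: the Hilbert space as an `A`-`ℂ` correspondence,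
with the graph norm of `D`, the seminorm `‖[D, ·]‖` on `A` and the zero seminorm on `ℂ`. -/
abbrev SpectralTriple.corr {A X : Type u} [CStarAlgebra A] [NormedAddCommGroup X]
    [InnerProductSpace ℂ X] [CompleteSpace X] (T : SpectralTriple A X) :
    Correspondence.{u, 0} where
  Mod := X
  A := A
  B := ℂ
  rightMod := Module.compHom X ((RingEquiv.toOpposite ℂ).symm : MulOpposite ℂ →+* ℂ)
  ip x y := ⟪x, y⟫_ℂ
  ip_add_right x y z := inner_add_right x y z
  ip_smul_right c x y := inner_smul_right x y c
  ip_op_smul_right b x y := (inner_smul_right x y b).trans (mul_comm _ _)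
  ip_star x y := (inner_conj_symm x y).symm
  ip_self_nonneg x := ⟨(‖x‖ : ℂ), by
    rw [inner_self_eq_norm_sq_to_K]
    simp [sq]⟩
  ip_self_eq_zero x := inner_self_eq_zero
  norm_eq x := by
    rw [inner_self_eq_norm_sq_to_K]
    simp
  act := T.rep.toAlgHom
  act_op_smul a b x := (T.rep a).map_smul b x
  act_adjoint a x y := by
    change ⟪T.rep a x, y⟫_ℂ = ⟪x, T.rep (star a) y⟫_ℂ
    rw [map_star, ContinuousLinearMap.star_eq_adjoint, ContinuousLinearMap.adjoint_inner_right]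
  DN := graphNorm T.D
  LA := T.lip
  LB _ := 0

/-! ### The spectral propinquity -/

/-- `(ς₁, ς₂)` is an `ε`-iso-iso of `[0, ∞)`. -/
def IsIsoIso (ε : ℝ) (ς₁ ς₂ : ℝ≥0 → ℝ≥0) : Prop :=
  ς₁ 0 = 0 ∧ ς₂ 0 = 0 ∧
    ∀ x y z : ℝ≥0, (x : ℝ) ≤ 1 / ε → (y : ℝ) ≤ 1 / ε → (z : ℝ) ≤ 1 / ε →
      |(|(ς₁ x + ς₁ y - z : ℝ)| - |(x + y - ς₂ z : ℝ)|)| < ε ∧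
      |(|(ς₂ x + ς₂ y - z : ℝ)| - |(x + y - ς₁ z : ℝ)|)| < ε

/-- The distance between two families of continuous functionals on a module with D-norm `DN`. -/
def kantorovichFamily {J P : Type*} [NormedAddCommGroup P] [NormedSpace ℂ P]
    (DN : P → ℝ≥0∞) (φ ψ : J → StrongDual ℂ P) : ℝ≥0∞ :=
  ⨆ (j : J) (x : P) (_ : DN x ≤ 1), ‖φ j x - ψ j x‖ₑ

/-- The families `(⟪exp (-i s(t) D) x, Q ·⟫)`, indexed by `t ∈ [0, 1/ε]`, for all `x` in the unit
ball of the graph norm of `D`. -/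
def orbitFamilies {X P : Type*} [NormedAddCommGroup X] [InnerProductSpace ℂ X] [CompleteSpace X]
    [NormedAddCommGroup P] [NormedSpace ℂ P] (D : X →ₗ.[ℂ] X) (Q : P →L[ℂ] X)
    (ε : ℝ) (s : ℝ≥0 → ℝ≥0) : Set ({t : ℝ≥0 // (t : ℝ) ≤ 1 / ε} → StrongDual ℂ P) :=
  {f | ∃ x : X, graphNorm D x ≤ 1 ∧
    ∀ t, f t = (innerSL ℂ (expI D (-(s t.1 : ℝ)) x)).comp Q}

section Propinquity

variable {F K G H : ℝ≥0}
  {A₁ X₁ A₂ X₂ : Type u}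
  [CStarAlgebra A₁] [NormedAddCommGroup X₁] [InnerProductSpace ℂ X₁] [CompleteSpace X₁]
  [CStarAlgebra A₂] [NormedAddCommGroup X₂] [InnerProductSpace ℂ X₂] [CompleteSpace X₂]

/-- One half of the `ε`-reach of a tunnel between spectral triples. -/
def halfReach (T₁ : SpectralTriple A₁ X₁) (T₂ : SpectralTriple A₂ X₂)
    (τ : Tunnel.{u, 0, u} F K G H T₁.corr T₂.corr) (ε : ℝ) (ς : ℝ≥0 → ℝ≥0) : ℝ≥0∞ :=
  hausdorffTo (kantorovichFamily τ.mid.DN)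
    (orbitFamilies T₁.D τ.left.onMod ε id) (orbitFamilies T₂.D τ.right.onMod ε ς)

/-- The `ε`-magnitude: the maximum of the extent and of the `ε`-reach. -/
def magnitude (T₁ : SpectralTriple A₁ X₁) (T₂ : SpectralTriple A₂ X₂)
    (τ : Tunnel.{u, 0, u} F K G H T₁.corr T₂.corr) (ε : ℝ) (ς₁ ς₂ : ℝ≥0 → ℝ≥0) : ℝ≥0∞ :=
  max τ.extent (max (halfReach T₁ T₂ τ ε ς₁) (halfReach T₂ T₁ τ.symm ε ς₂))

variable (F K G H) in
/-- The spectral propinquity. -/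
def spectralPropinquity (T₁ : SpectralTriple A₁ X₁) (T₂ : SpectralTriple A₂ X₂) : ℝ :=
  sInf ({√2 / 2} ∪ {ε : ℝ | 0 < ε ∧ ∃ τ : Tunnel.{u, 0, u} F K G H T₁.corr T₂.corr,
    ∃ ς₁ ς₂ : ℝ≥0 → ℝ≥0, IsIsoIso ε ς₁ ς₂ ∧
      magnitude T₁ T₂ τ ε ς₁ ς₂ < ENNReal.ofReal ε})

end Propinquity

end SpectralPropinquity

end

/-! Since `D` has compact resolvent, its spectrum consists of real eigenvalues, and for a vector `y`
the function `t ↦ ⟪exp(-itD) y, y⟫` is the Fourier transform of the spectral measure of `y`, a sum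
of masses at eigenvalues (`hasSum_inner_expI_neg`).

Let `x` be an eigenvector of `D₁` for `l`, of graph norm one. A tunnel of small reach provides `y`
in the second space whose orbit imitates that of `x`, which is `x` times a phase. Testing on a lift
of `y/2` shows that `⟪exp(-itD₂) y, y⟫` is within `5ε` of `exp(itl) ‖y‖²` for `0 ≤ t ≤ 1/ε`; testing
on a lift of `x/2` bounds `‖y‖` below. If `D₂` had no spectrum within `κ` of `l`, averaging against
`exp(-itl)` over `[0, 1/ε]` would make `‖y‖²` of order `ε` (`mul_le_of_norm_sub_tsum_exp_le`), a
contradiction for small `ε`. This is `exists_mem_spectrum_of_halfReach_lt`.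

The smallness required depends only on `κ` and a bound for `|l|`, and the argument is symmetric in
the two triples. Both inclusions follow, the second because the limit spectrum is closed
(`mem_spectrum_of_tendsto`). -/

namespace SpectralPropinquity

/-! ### Eigenvectors of a self-adjoint operator with compact resolvent -/

section SpectralTheory

variable {X : Type*} [NormedAddCommGroup X] [InnerProductSpace ℂ X] {D : X →ₗ.[ℂ] X}

theorem mem_eigenspace_iff {r : ℝ} {x : X} :
    x ∈ eigenspace D r ↔ ∃ h : x ∈ D.domain, D ⟨x, h⟩ = (r : ℂ) • x := by
  unfold eigenspace
  rw [Submodule.mem_map]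
  constructor
  · rintro ⟨⟨y, hy⟩, hk, rfl⟩
    refine ⟨hy, ?_⟩
    rw [LinearMap.mem_ker, LinearMap.sub_apply, sub_eq_zero] at hk
    exact hk
  · rintro ⟨h, hx⟩
    refine ⟨⟨x, h⟩, ?_, rfl⟩
    rw [LinearMap.mem_ker, LinearMap.sub_apply, sub_eq_zero]
    exact hx

/-- Factor `D² - r² = (D - r)(D + r)`: the vectors `Dx ± rx` are eigenvectors for `±r` (or zero),
and their difference is `2rx`. -/
theorem mem_iSup_eigenspace_of_sq {x : X} (hx : x ∈ D.domain) (hDx : D ⟨x, hx⟩ ∈ D.domain)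
    {r : ℝ} (hr : r ≠ 0) (h : D ⟨D ⟨x, hx⟩, hDx⟩ = ((r : ℂ) ^ 2) • x) :
    x ∈ ⨆ s : ℝ, eigenspace D s := by
  have hr' : (r : ℂ) ≠ 0 := by exact_mod_cast hr
  have key : ∀ s : ℝ, (s : ℂ) ^ 2 = (r : ℂ) ^ 2 → D ⟨x, hx⟩ + (s : ℂ) • x ∈ eigenspace D s := by
    intro s hs
    refine mem_eigenspace_iff.2 ⟨D.domain.add_mem hDx (D.domain.smul_mem _ hx), ?_⟩
    have e : (⟨D ⟨x, hx⟩ + (s : ℂ) • x, D.domain.add_mem hDx (D.domain.smul_mem _ hx)⟩ : D.domain)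
        = ⟨D ⟨x, hx⟩, hDx⟩ + (s : ℂ) • ⟨x, hx⟩ := rfl
    rw [e, D.map_add, D.map_smul, h, smul_add, smul_smul, ← sq, hs, add_comm]
  have h1 := key r rfl
  have h2 := key (-r) (by push_cast; ring)
  have e : x = (2 * (r : ℂ))⁻¹ •
      ((D ⟨x, hx⟩ + (r : ℂ) • x) - (D ⟨x, hx⟩ + ((-r : ℝ) : ℂ) • x)) := by
    rw [add_sub_add_left_eq_sub, ← sub_smul, smul_smul]
    have : (2 * (r : ℂ))⁻¹ * ((r : ℂ) - ((-r : ℝ) : ℂ)) = 1 := by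
      push_cast; field_simp; norm_num
    rw [this, one_smul]
  rw [e]
  exact Submodule.smul_mem _ _ (Submodule.sub_mem _ (Submodule.mem_iSup_of_mem r h1)
    (Submodule.mem_iSup_of_mem (-r) h2))

theorem ofReal_mem_spectrum_of_mem_eigenspace {r : ℝ} {e : X} (he : e ∈ eigenspace D r)
    (h0 : e ≠ 0) : (r : ℂ) ∈ spectrum D := by
  rintro ⟨Q, hQ⟩
  obtain ⟨h, h'⟩ := mem_eigenspace_iff.1 he
  have := hQ.2 ⟨e, h⟩
  rw [h', sub_self, map_zero] at this
  exact h0 this.symm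

variable {R : X →L[ℂ] X}

theorem map_resolvent_apply (hR : IsResolvent D (-Complex.I) R) (x : X) :
    ∃ h : R x ∈ D.domain, D ⟨R x, h⟩ = x - Complex.I • R x := by
  obtain ⟨hd, hd'⟩ := hR.1 x
  exact ⟨hd, by rw [eq_sub_iff_add_eq, ← sub_neg_eq_add, ← neg_smul, hd']⟩

theorem resolvent_map_apply (hR : IsResolvent D (-Complex.I) R) (x : D.domain) :
    R (D x) = (x : X) - Complex.I • R x := by
  have := hR.2 x
  rwa [map_sub, map_smul, neg_smul, sub_neg_eq_add, ← eq_sub_iff_add_eq] at this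

variable [CompleteSpace X]

theorem inner_map_left_eq (hD : IsSelfAdjoint D) (x y : D.domain) :
    ⟪D x, (y : X)⟫_ℂ = ⟪(x : X), D y⟫_ℂ := by
  have h := LinearPMap.adjoint_isFormalAdjoint hD.dense_domain
  rw [LinearPMap.isSelfAdjoint_def.1 hD] at h
  exact h x y

theorem inner_map_self_eq (hD : IsSelfAdjoint D) {r : ℝ} {e : X} (he : e ∈ eigenspace D r)
    (x : D.domain) : ⟪e, D x⟫_ℂ = r * ⟪e, (x : X)⟫_ℂ := by
  obtain ⟨h, h'⟩ := mem_eigenspace_iff.1 he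
  rw [← inner_map_left_eq hD ⟨e, h⟩ x, h', inner_smul_left, Complex.conj_ofReal]

theorem eq_ofReal_of_map_eq_smul (hD : IsSelfAdjoint D) {z : ℂ} {e : D.domain} (he : (e : X) ≠ 0)
    (h : D e = z • (e : X)) : z = (z.re : ℂ) := by
  have h1 := inner_map_left_eq hD e e
  rw [h, inner_smul_left, inner_smul_right] at h1
  have h2 := mul_right_cancel₀ (inner_self_ne_zero.2 he) h1
  exact (Complex.conj_eq_iff_re.1 h2).symm

theorem mem_domain_of_forall_inner (hD : IsSelfAdjoint D) {y w : X}
    (h : ∀ x : D.domain, ⟪w, (x : X)⟫_ℂ = ⟪y, D x⟫_ℂ) : ∃ hy : y ∈ D.domain, D ⟨y, hy⟩ = w := by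
  have hy : y ∈ D.adjoint.domain := D.mem_adjoint_domain_of_exists y ⟨w, h⟩
  have e := LinearPMap.adjoint_apply_eq hD.dense_domain ⟨y, hy⟩ h
  have hs := LinearPMap.isSelfAdjoint_def.1 hD
  -- The membership proof depends on the operator, so the equality of `D.adjoint` with `D` is
  -- transported through a variable `D'`.
  have key : ∀ D' : X →ₗ.[ℂ] X, D' = D → ∀ hy : y ∈ D'.domain, D' ⟨y, hy⟩ = w →
      ∃ hy : y ∈ D.domain, D ⟨y, hy⟩ = w := by
    rintro _ rfl hy h
    exact ⟨hy, h⟩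
  exact key _ hs hy e

/-- The adjoint of `(D + i)⁻¹` is `(D - i)⁻¹`; this half of the assertion is all that is used. -/
theorem adjoint_resolvent_apply (hD : IsSelfAdjoint D) (hR : IsResolvent D (-Complex.I) R)
    (y : X) :
    ∃ h : R.adjoint y ∈ D.domain, D ⟨R.adjoint y, h⟩ = y + Complex.I • R.adjoint y := by
  apply mem_domain_of_forall_inner hD
  intro x
  rw [inner_add_left, inner_smul_left, Complex.conj_I, ContinuousLinearMap.adjoint_inner_left,
    ContinuousLinearMap.adjoint_inner_left, resolvent_map_apply hR, inner_sub_right,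
    inner_smul_right]
  ring

/-- Here `R* R = (1 + D²)⁻¹`, so an eigenvector for `μ` satisfies `D² x = (μ⁻¹ - 1) x`, and `μ⁻¹ - 1
= (‖Dx‖/‖x‖)²` is a real square. -/
theorem eigenspace_adjoint_mul_le (hD : IsSelfAdjoint D) (hR : IsResolvent D (-Complex.I) R)
    (μ : ℂ) : Module.End.eigenspace ((R.adjoint ∘L R : X →L[ℂ] X) : Module.End ℂ X) μ ≤
      ⨆ r : ℝ, eigenspace D r := by
  intro x hx
  rw [Module.End.mem_eigenspace_iff] at hx
  change R.adjoint (R x) = μ • x at hx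
  by_cases hx0 : x = 0
  · rw [hx0]; exact Submodule.zero_mem _
  obtain ⟨hRx, hRx'⟩ := map_resolvent_apply hR x
  -- `R` is injective, hence so is `R* R`.
  have hμ : μ ≠ 0 := by
    rintro rfl
    have h1 : ⟪R x, R x⟫_ℂ = 0 := by
      rw [← ContinuousLinearMap.adjoint_inner_left, hx, zero_smul, inner_zero_left]
    rw [inner_self_eq_zero] at h1
    apply hx0
    have : (⟨R x, hRx⟩ : D.domain) = 0 := Subtype.ext h1
    rw [this, h1, D.map_zero, smul_zero, sub_zero] at hRx'
    exact hRx'.symm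
  have hxe : x = μ⁻¹ • R.adjoint (R x) := by rw [hx, smul_smul, inv_mul_cancel₀ hμ, one_smul]
  obtain ⟨ha, ha'⟩ := adjoint_resolvent_apply hD hR (R x)
  have hxd : x ∈ D.domain := by rw [hxe]; exact D.domain.smul_mem _ ha
  have hDx : D ⟨x, hxd⟩ = μ⁻¹ • R x + Complex.I • x := by
    have : (⟨x, hxd⟩ : D.domain) = μ⁻¹ • ⟨R.adjoint (R x), ha⟩ := Subtype.ext hxe
    rw [this, D.map_smul, ha', smul_add, smul_comm, ← hxe]
  have hDxd : D ⟨x, hxd⟩ ∈ D.domain := by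
    rw [hDx]; exact D.domain.add_mem (D.domain.smul_mem _ hRx) (D.domain.smul_mem _ hxd)
  have hDDx : D ⟨D ⟨x, hxd⟩, hDxd⟩ = (μ⁻¹ - 1) • x := by
    have : (⟨D ⟨x, hxd⟩, hDxd⟩ : D.domain) = μ⁻¹ • ⟨R x, hRx⟩ + Complex.I • ⟨x, hxd⟩ :=
      Subtype.ext hDx
    rw [this, D.map_add, D.map_smul, D.map_smul, hRx', hDx, smul_add, smul_smul Complex.I Complex.I,
      Complex.I_mul_I, smul_sub, sub_smul, smul_comm Complex.I]
    module
  have hn : (‖D ⟨x, hxd⟩‖ : ℂ) ^ 2 = (μ⁻¹ - 1) * (‖x‖ : ℂ) ^ 2 := by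
    have h1 := inner_map_left_eq hD ⟨x, hxd⟩ ⟨D ⟨x, hxd⟩, hDxd⟩
    rw [hDDx, inner_smul_right, inner_self_eq_norm_sq_to_K, inner_self_eq_norm_sq_to_K] at h1
    exact h1
  have hxn : ‖x‖ ≠ 0 := norm_ne_zero_iff.2 hx0
  have hxn' : (‖x‖ : ℂ) ≠ 0 := by exact_mod_cast hxn
  set r : ℝ := ‖D ⟨x, hxd⟩‖ / ‖x‖ with hr
  have hr2 : (r : ℂ) ^ 2 = μ⁻¹ - 1 := by
    rw [hr]; push_cast
    rw [div_pow, hn]; field_simp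
  by_cases hr0 : r = 0
  · have : D ⟨x, hxd⟩ = 0 := by
      rw [hr, div_eq_zero_iff] at hr0
      exact norm_eq_zero.1 (hr0.resolve_right hxn)
    exact Submodule.mem_iSup_of_mem 0 (mem_eigenspace_iff.2 ⟨hxd, by simp [this]⟩)
  · exact mem_iSup_eigenspace_of_sq hxd hDxd hr0 (by rw [hDDx, hr2])

/-- The spectral theorem for compact symmetric operators is applied to `R* R`, because `R` itself is
in general not symmetric. -/
theorem iSup_eigenspace_orthogonal_eq_bot (hD : IsSelfAdjoint D)
    (hR : IsResolvent D (-Complex.I) R) (hc : IsCompactOperator R) :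
    (⨆ r : ℝ, eigenspace D r)ᗮ = ⊥ := by
  have h1 : IsCompactOperator (R.adjoint ∘L R : X →L[ℂ] X) := hc.clm_comp R.adjoint
  have h2 : ((R.adjoint ∘L R : X →L[ℂ] X) : X →ₗ[ℂ] X).IsSymmetric := by
    intro x y
    change ⟪R.adjoint (R x), y⟫_ℂ = ⟪x, R.adjoint (R y)⟫_ℂ
    rw [ContinuousLinearMap.adjoint_inner_left, ContinuousLinearMap.adjoint_inner_right]
  rw [eq_bot_iff, ← ContinuousLinearMap.orthogonalComplement_iSup_eigenspaces_eq_bot h1 h2]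
  exact Submodule.orthogonal_le (iSup_le fun μ => eigenspace_adjoint_mul_le hD hR μ)

/-! ### Spectral decomposition and the unitary group -/

/-- The orthogonal projection onto the closed eigenspace of `r`. -/
noncomputable def eigenProj (D : X →ₗ.[ℂ] X) (r : ℝ) : X →L[ℂ] X :=
  (eigenspace D r).topologicalClosure.starProjection

theorem eigenProj_mem (r : ℝ) (x : X) :
    eigenProj D r x ∈ (eigenspace D r).topologicalClosure :=
  Submodule.starProjection_apply_mem _ _

theorem isOrtho_eigenspace (hD : IsSelfAdjoint D) {r s : ℝ} (hrs : r ≠ s) :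
    (eigenspace D r).topologicalClosure ⟂ (eigenspace D s).topologicalClosure := by
  have h : eigenspace D r ⟂ eigenspace D s := by
    rw [Submodule.isOrtho_iff_inner_eq]
    intro x hx y hy
    obtain ⟨h, h'⟩ := mem_eigenspace_iff.1 hy
    have h1 := inner_map_self_eq hD hx ⟨y, h⟩
    rw [h', inner_smul_right] at h1
    have : ((s : ℂ) - r) * ⟪x, y⟫_ℂ = 0 := by rw [sub_mul, h1, sub_self]
    refine (mul_eq_zero.1 this).resolve_left (sub_ne_zero.2 ?_)
    exact_mod_cast hrs.symm
  rw [Submodule.isOrtho_iff_le]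
  refine Submodule.topologicalClosure_minimal _ ?_ (Submodule.isClosed_orthogonal _)
  rw [Submodule.orthogonal_closure]
  exact h.le

theorem orthogonalFamily_eigenspace (hD : IsSelfAdjoint D) :
    OrthogonalFamily ℂ (fun r : ℝ => (eigenspace D r).topologicalClosure)
      fun r => ((eigenspace D r).topologicalClosure).subtypeₗᵢ :=
  OrthogonalFamily.of_pairwise fun _ _ h => isOrtho_eigenspace hD h

theorem eigenProj_eq_self {r : ℝ} {x : X} (hx : x ∈ (eigenspace D r).topologicalClosure) :
    eigenProj D r x = x :=
  Submodule.starProjection_eq_self_iff.2 hx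

theorem eigenProj_eq_zero (hD : IsSelfAdjoint D) {r s : ℝ} (hrs : r ≠ s) {x : X}
    (hx : x ∈ (eigenspace D r).topologicalClosure) : eigenProj D s x = 0 :=
  (Submodule.starProjection_apply_eq_zero_iff _).2 ((isOrtho_eigenspace hD hrs).le hx)

theorem hasSum_eigenProj (hD : IsSelfAdjoint D) (hR : IsResolvent D (-Complex.I) R)
    (hc : IsCompactOperator R) (x : X) : HasSum (fun r : ℝ => eigenProj D r x) x := by
  have htot : ⊤ ≤ (⨆ r : ℝ, (eigenspace D r).topologicalClosure).topologicalClosure := by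
    rw [top_le_iff, Submodule.topologicalClosure_eq_top_iff, eq_bot_iff,
      ← iSup_eigenspace_orthogonal_eq_bot hD hR hc]
    exact Submodule.orthogonal_le (iSup_mono fun r => Submodule.le_topologicalClosure _)
  have hV := IsHilbertSum.mkInternal (𝕜 := ℂ)
    (fun r : ℝ => (eigenspace D r).topologicalClosure) (orthogonalFamily_eigenspace hD) htot
  obtain ⟨w, rfl⟩ := hV.linearIsometryEquiv.symm.surjective x
  have hs := hV.hasSum_linearIsometryEquiv_symm w
  convert hs using 1
  ext r
  -- By orthogonality, projecting the Hilbert sum onto the eigenspace of `r` leaves only its `r`-th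
  -- component.
  have h1 := hs.mapL (eigenProj D r)
  have h2 : HasSum (fun s : ℝ => eigenProj D r (w s : X)) (eigenProj D r (w r : X)) :=
    hasSum_single r fun s hs => eigenProj_eq_zero hD hs (w s).2
  rw [h1.unique h2]
  exact eigenProj_eq_self (w r).2

theorem inner_eigenProj_self (r : ℝ) (x : X) :
    ⟪x, eigenProj D r x⟫_ℂ = ((‖eigenProj D r x‖ ^ 2 : ℝ) : ℂ) := by
  have h1 : eigenProj D r (eigenProj D r x) = eigenProj D r x :=
    eigenProj_eq_self (eigenProj_mem r x)
  have h2 := Submodule.inner_starProjection_left_eq_right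
    (eigenspace D r).topologicalClosure x (eigenProj D r x)
  change ⟪eigenProj D r x, eigenProj D r x⟫_ℂ = ⟪x, eigenProj D r (eigenProj D r x)⟫_ℂ at h2
  rw [h1] at h2
  rw [← h2, inner_self_eq_norm_sq_to_K]
  simp

theorem hasSum_norm_sq_eigenProj (hD : IsSelfAdjoint D) (hR : IsResolvent D (-Complex.I) R)
    (hc : IsCompactOperator R) (x : X) :
    HasSum (fun r : ℝ => ‖eigenProj D r x‖ ^ 2) (‖x‖ ^ 2) := by
  have h := (hasSum_eigenProj hD hR hc x).mapL (innerSL ℂ x)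
  simp only [innerSL_apply_apply, inner_eigenProj_self, inner_self_eq_norm_sq_to_K] at h
  refine Complex.hasSum_ofReal.1 ?_
  push_cast at h ⊢
  exact h

/-- The phases have modulus one, so summability is that of `‖eigenProj D r x‖ ^ 2`. -/
theorem hasSum_expI (hD : IsSelfAdjoint D) (hR : IsResolvent D (-Complex.I) R)
    (hc : IsCompactOperator R) (t : ℝ) (x : X) :
    HasSum (fun r : ℝ => Complex.exp (Complex.I * t * r) • eigenProj D r x) (expI D t x) := by
  refine Summable.hasSum ?_
  have h := (orthogonalFamily_eigenspace hD).summable_iff_norm_sq_summable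
    (fun r => Complex.exp (Complex.I * t * r) • ⟨eigenProj D r x, eigenProj_mem r x⟩)
  refine h.2 ?_
  convert (hasSum_norm_sq_eigenProj hD hR hc x).summable using 2 with r
  rw [norm_smul]
  have : Complex.I * t * r = ((t * r : ℝ) : ℂ) * Complex.I := by push_cast; ring
  rw [this, Complex.norm_exp_ofReal_mul_I, one_mul]
  rfl

theorem expI_zero (hD : IsSelfAdjoint D) (hR : IsResolvent D (-Complex.I) R)
    (hc : IsCompactOperator R) (x : X) : expI D 0 x = x := by
  refine (hasSum_expI hD hR hc 0 x).unique ?_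
  simpa using hasSum_eigenProj hD hR hc x

theorem expI_of_mem_eigenspace (hD : IsSelfAdjoint D) (t : ℝ) {r : ℝ} {x : X}
    (hx : x ∈ eigenspace D r) : expI D t x = Complex.exp (Complex.I * t * r) • x := by
  have hx' := (eigenspace D r).le_topologicalClosure hx
  change ∑' s : ℝ, Complex.exp (Complex.I * t * s) • eigenProj D s x = _
  rw [tsum_eq_single r, eigenProj_eq_self hx']
  intro s hs
  rw [eigenProj_eq_zero hD hs.symm hx', smul_zero]

theorem hasSum_inner_expI_neg (hD : IsSelfAdjoint D) (hR : IsResolvent D (-Complex.I) R)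
    (hc : IsCompactOperator R) (t : ℝ) (x : X) :
    HasSum (fun r : ℝ => Complex.exp (Complex.I * t * r) * ((‖eigenProj D r x‖ ^ 2 : ℝ) : ℂ))
      ⟪expI D (-t) x, x⟫_ℂ := by
  have h := (hasSum_expI hD hR hc (-t) x).mapL (innerSL ℂ x)
  -- The inner product is antilinear on the left: conjugation turns the phases at time `-t` into
  -- phases at time `t`.
  have h2 := Complex.hasSum_conj'.2 h
  simp only [innerSL_apply_apply, inner_smul_right, inner_eigenProj_self, inner_conj_symm] at h2
  convert h2 using 2 with r
  simp only [map_mul, Complex.conj_ofReal, ← Complex.exp_conj, Complex.conj_I]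
  congr 2
  push_cast
  ring

theorem eigenProj_map (hD : IsSelfAdjoint D) (r : ℝ) (x : D.domain) :
    eigenProj D r (D x) = (r : ℂ) • eigenProj D r (x : X) := by
  rw [← map_smul, ← sub_eq_zero, ← map_sub]
  refine (Submodule.starProjection_apply_eq_zero_iff _).2 ?_
  rw [Submodule.orthogonal_closure, Submodule.mem_orthogonal]
  intro e he
  rw [inner_sub_right, inner_map_self_eq hD he, inner_smul_right, sub_self]

theorem exists_mem_eigenspace_of_eigenProj_ne_zero {r : ℝ} {x : X} (h : eigenProj D r x ≠ 0) :
    ∃ e ∈ eigenspace D r, e ≠ 0 := by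
  by_contra! H
  have hb : eigenspace D r = ⊥ := (Submodule.eq_bot_iff _).2 H
  apply h
  refine (Submodule.starProjection_apply_eq_zero_iff _).2 ?_
  rw [Submodule.orthogonal_closure, hb, Submodule.bot_orthogonal_eq_top]
  trivial

/-- With `c = z + i`, formally `D - z = c (c⁻¹ - R)(D + i)`. By the Fredholm alternative either
`c⁻¹` is an eigenvalue of the compact operator `R`, which yields an eigenvector of `D` for `z`, or
`c⁻¹ - R` is invertible and so is `D - z`. -/
theorem exists_mem_eigenspace_of_mem_spectrum (hD : IsSelfAdjoint D)
    (hR : IsResolvent D (-Complex.I) R) (hc : IsCompactOperator R) {z : ℂ} (hz : z ∈ spectrum D) :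
    ∃ r : ℝ, z = r ∧ ∃ e ∈ eigenspace D r, e ≠ 0 := by
  have hz1 : z + Complex.I ≠ 0 := by
    intro h
    exact hz ⟨R, by rwa [eq_neg_of_add_eq_zero_left h]⟩
  set c : ℂ := z + Complex.I with hcdef
  rcases hc.hasEigenvalue_or_mem_resolventSet (inv_ne_zero hz1) with h | h
  · obtain ⟨e, he⟩ := h.exists_hasEigenvector
    have he0 := he.2
    have he1 : R e = c⁻¹ • e := he.apply_eq_smul
    obtain ⟨hd, hd'⟩ := map_resolvent_apply hR e
    have hee : e = c • R e := by rw [he1, smul_smul, mul_inv_cancel₀ hz1, one_smul]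
    have hed : e ∈ D.domain := by rw [hee]; exact D.domain.smul_mem _ hd
    have hDe : D ⟨e, hed⟩ = z • e := by
      have h1 : (⟨e, hed⟩ : D.domain) = c • ⟨R e, hd⟩ := Subtype.ext hee
      rw [h1, D.map_smul, hd', smul_sub, smul_comm, ← hee, ← sub_smul, hcdef, add_sub_cancel_right]
    have hzr := eq_ofReal_of_map_eq_smul hD (e := ⟨e, hed⟩) he0 hDe
    exact ⟨z.re, hzr, e, mem_eigenspace_iff.2 ⟨hed, by rw [hDe, ← hzr]⟩, he0⟩
  · exfalso
    apply hz
    rw [spectrum.mem_resolventSet_iff] at h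
    obtain ⟨W, hW⟩ := h
    have hW1 : ∀ x, c⁻¹ • (W⁻¹ : (X →L[ℂ] X)ˣ).val x - R ((W⁻¹ : (X →L[ℂ] X)ˣ).val x) = x := by
      intro x
      have := congrArg (fun T : X →L[ℂ] X => T x) W.mul_inv
      rw [hW] at this
      simpa [Algebra.algebraMap_eq_smul_one] using this
    have hW2 : ∀ x, (W⁻¹ : (X →L[ℂ] X)ˣ).val (c⁻¹ • x - R x) = x := by
      intro x
      have := congrArg (fun T : X →L[ℂ] X => T x) W.inv_mul
      rw [hW] at this
      simpa [Algebra.algebraMap_eq_smul_one] using this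
    refine ⟨c⁻¹ • ((W⁻¹ : (X →L[ℂ] X)ˣ).val ∘L R), ?_, ?_⟩
    · intro x
      -- The equation `(c⁻¹ - R) y = R x` reads `c⁻¹ y = R (x + y)`, which places the candidate
      -- value in the domain of `D`.
      set y := (W⁻¹ : (X →L[ℂ] X)ˣ).val (R x) with hy
      have hy1 : c⁻¹ • y = R (x + y) := by
        have := hW1 (R x)
        rw [← hy, sub_eq_iff_eq_add] at this
        rw [this, map_add]
      have hy2 : y = c • R (x + y) := by rw [← hy1, smul_smul, mul_inv_cancel₀ hz1, one_smul]
      obtain ⟨hd, hd'⟩ := map_resolvent_apply hR (x + y)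
      have e1 : (c⁻¹ • ((W⁻¹ : (X →L[ℂ] X)ˣ).val ∘L R)) x = R (x + y) := hy1
      have hd1 : (c⁻¹ • ((W⁻¹ : (X →L[ℂ] X)ˣ).val ∘L R)) x ∈ D.domain := by rw [e1]; exact hd
      refine ⟨hd1, ?_⟩
      have e2 : (⟨(c⁻¹ • ((W⁻¹ : (X →L[ℂ] X)ˣ).val ∘L R)) x, hd1⟩ : D.domain) = ⟨R (x + y), hd⟩ :=
        Subtype.ext e1
      rw [e2, hd', e1, sub_sub, ← add_smul, add_comm Complex.I, ← hcdef, ← hy2, add_sub_cancel_right]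
    · intro x
      change c⁻¹ • (W⁻¹ : (X →L[ℂ] X)ˣ).val (R (D x - z • (x : X))) = x
      have : R (D x - z • (x : X)) = c • (c⁻¹ • (x : X) - R x) := by
        rw [map_sub, resolvent_map_apply hR, map_smul, smul_sub, smul_smul, mul_inv_cancel₀ hz1, one_smul, sub_sub,
          ← add_smul, add_comm Complex.I]
      rw [this, map_smul, hW2, smul_smul, inv_mul_cancel₀ hz1, one_smul]

theorem nonempty_spectrum [Nontrivial X] (hD : IsSelfAdjoint D)
    (hR : IsResolvent D (-Complex.I) R) (hc : IsCompactOperator R) :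
    ∃ r : ℝ, (r : ℂ) ∈ spectrum D := by
  obtain ⟨x, hx⟩ := exists_ne (0 : X)
  by_contra! H
  apply hx
  refine (hasSum_eigenProj hD hR hc x).unique ?_
  convert hasSum_zero with r
  by_contra h
  obtain ⟨e, he, he0⟩ := exists_mem_eigenspace_of_eigenProj_ne_zero h
  exact H r (ofReal_mem_spectrum_of_mem_eigenspace he he0)

/-- The spectrum is closed: if `Q` inverts `D - r` and `e` is an eigenvector for `s`, then `e = (s -
r) Q e`, so `|s - r| ‖Q‖ ≥ 1`. -/
theorem mem_spectrum_of_tendsto (hD : IsSelfAdjoint D) (hR : IsResolvent D (-Complex.I) R)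
    (hc : IsCompactOperator R) {r : ℝ}
    (h : ∀ δ > 0, ∃ s : ℝ, |s - r| < δ ∧ (s : ℂ) ∈ spectrum D) : (r : ℂ) ∈ spectrum D := by
  rintro ⟨Q, hQ⟩
  obtain ⟨s, hs, hs'⟩ := h (‖Q‖ + 1)⁻¹ (by positivity)
  obtain ⟨s', hss', e, he, he0⟩ := exists_mem_eigenspace_of_mem_spectrum hD hR hc hs'
  obtain rfl : s = s' := by exact_mod_cast hss'
  obtain ⟨hd, hd'⟩ := mem_eigenspace_iff.1 he
  have h1 := hQ.2 ⟨e, hd⟩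
  rw [hd', ← sub_smul, map_smul] at h1
  have hn : 0 < ‖e‖ := norm_pos_iff.2 he0
  have h2 : ‖e‖ ≤ |s - r| * (‖Q‖ * ‖e‖) := by
    calc ‖e‖ = ‖((s : ℂ) - r) • Q e‖ := by rw [h1]
      _ = |s - r| * ‖Q e‖ := by
        rw [norm_smul, ← Complex.ofReal_sub, Complex.norm_real, Real.norm_eq_abs]
      _ ≤ _ := by gcongr; exact Q.le_opNorm e
  have h3 : |s - r| * (‖Q‖ + 1) < 1 := by
    rwa [← one_div, lt_div_iff₀ (by positivity)] at hs
  nlinarith [abs_nonneg (s - r)]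

end SpectralTheory

/-! ### Estimates on the real line -/

/-- After multiplication by `exp(-itl)` and integration over `[0, T]`, the constant term gives `T *
S`, while the other frequencies have size at least `κ`, so their primitives stay bounded by `S / κ`
at both endpoints. -/
theorem mul_le_of_norm_sub_tsum_exp_le {w : ℝ → ℝ} {S l κ T δ : ℝ} (hw : ∀ r, 0 ≤ w r)
    (hS : HasSum w S) (hκ : 0 < κ) (hT : 0 ≤ T) (hgap : ∀ r, w r ≠ 0 → κ ≤ |r - l|)
    (h : ∀ t, 0 ≤ t → t ≤ T → ‖Complex.exp (Complex.I * t * l) * S -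
      ∑' r : ℝ, Complex.exp (Complex.I * t * r) * (w r : ℂ)‖ ≤ δ) :
    T * S ≤ δ * T + 2 * (S / κ) := by
  have hexp : ∀ a b : ℝ, ‖Complex.exp (Complex.I * a * b)‖ = 1 := by
    intro a b
    rw [mul_assoc, ← Complex.ofReal_mul, Complex.norm_exp_I_mul_ofReal]
  -- Primitive of `g' r`. At `r = l` the denominator vanishes, but then `w r = 0` by the gap
  -- hypothesis.
  let g : ℝ → ℝ → ℂ := fun r t =>
    (w r : ℂ) * Complex.exp (Complex.I * t * (r - l : ℝ)) / (Complex.I * (r - l : ℝ))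
  let g' : ℝ → ℝ → ℂ := fun r t => (w r : ℂ) * Complex.exp (Complex.I * t * (r - l : ℝ))
  have hg : ∀ r t, HasDerivAt (g r) (g' r t) t := by
    intro r t
    by_cases hr : w r = 0
    · have h1 : g r = fun _ => 0 := by ext; simp [g, hr]
      have h2 : g' r t = 0 := by simp [g', hr]
      rw [h1, h2]
      exact hasDerivAt_const _ _
    · have hne : ((r - l : ℝ) : ℂ) ≠ 0 := by
        have := hgap r hr
        exact_mod_cast abs_pos.1 (hκ.trans_le this)
      have h1 : HasDerivAt (fun t : ℝ => Complex.I * (t : ℂ) * (r - l : ℝ))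
          (Complex.I * (r - l : ℝ)) t := by
        have := ((Complex.ofRealCLM.hasDerivAt (x := t)).const_mul Complex.I).mul_const
          ((r - l : ℝ) : ℂ)
        simpa using this
      have h2 := (h1.cexp.const_mul (w r : ℂ)).div_const (Complex.I * (r - l : ℝ))
      refine h2.congr_deriv ?_
      have : Complex.I * ((r - l : ℝ) : ℂ) ≠ 0 := mul_ne_zero Complex.I_ne_zero hne
      simp only [g']
      field_simp
  have hg' : ∀ r t, ‖g' r t‖ ≤ w r := by
    intro r t
    rw [norm_mul, hexp, mul_one, Complex.norm_real, Real.norm_eq_abs, abs_of_nonneg (hw r)]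
  have hgb : ∀ r t, ‖g r t‖ ≤ w r / κ := by
    intro r t
    rw [norm_div, norm_mul, hexp, mul_one, Complex.norm_real, Real.norm_eq_abs,
      abs_of_nonneg (hw r), norm_mul, Complex.norm_I, one_mul, Complex.norm_real, Real.norm_eq_abs]
    by_cases hr : w r = 0
    · simp [hr]
    · exact div_le_div_of_nonneg_left (hw r) hκ (hgap r hr)
  have hsum : ∀ t, ‖∑' r, g r t‖ ≤ S / κ := fun t =>
    tsum_of_norm_bounded (hS.div_const κ) fun r => hgb r t
  have hderiv : ∀ t, HasDerivAt (fun t : ℝ => (t : ℂ) * S - ∑' r, g r t)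
      (S - ∑' r, g' r t) t := by
    intro t
    have h1 := hasDerivAt_tsum hS.summable hg hg' (y₀ := 0)
      (Summable.of_norm_bounded (hS.summable.div_const κ) fun r => hgb r 0) t
    have h2 : HasDerivAt (fun t : ℝ => (t : ℂ) * S) S t := by
      simpa using (Complex.ofRealCLM.hasDerivAt (x := t)).mul_const (S : ℂ)
    exact h2.sub h1
  have hbound : ∀ t, 0 ≤ t → t ≤ T → ‖(S : ℂ) - ∑' r, g' r t‖ ≤ δ := by
    intro t h0 hT
    refine le_trans (le_of_eq ?_) (h t h0 hT)
    rw [← one_mul ‖(S : ℂ) - ∑' r, g' r t‖, ← hexp t l, ← norm_mul, mul_sub, ← tsum_mul_left]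
    have e : ∀ r, Complex.exp (Complex.I * t * l) * g' r t =
        Complex.exp (Complex.I * t * r) * (w r : ℂ) := by
      intro r
      simp only [g']
      rw [mul_left_comm, ← Complex.exp_add, mul_comm]
      congr 2
      push_cast
      ring
    simp_rw [e]
  -- The mean value inequality replaces the integral.
  have hmv := norm_image_sub_le_of_norm_deriv_le_segment' (a := 0) (b := T)
    (fun t _ => (hderiv t).hasDerivWithinAt) (fun t ht => hbound t ht.1 ht.2.le) T
    (Set.right_mem_Icc.2 hT)
  simp only [Complex.ofReal_zero, zero_mul, zero_sub, sub_zero] at hmv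
  have hST : ‖(T : ℂ) * S‖ = T * S := by
    rw [← Complex.ofReal_mul, Complex.norm_real, Real.norm_eq_abs,
      abs_of_nonneg (mul_nonneg hT (hS.nonneg hw))]
  have e : (T : ℂ) * S = ((T : ℂ) * S - ∑' r, g r T - -∑' r, g r 0) + ∑' r, g r T
      - ∑' r, g r 0 := by ring
  rw [← hST, e]
  have h1 := norm_sub_le (((T : ℂ) * S - ∑' r, g r T - -∑' r, g r 0) + ∑' r, g r T)
    (∑' r, g r 0)
  have h2 := norm_add_le ((T : ℂ) * S - ∑' r, g r T - -∑' r, g r 0) (∑' r, g r T)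
  linarith [hsum T, hsum 0]

theorem IsIsoIso.symm {ε : ℝ} {ς₁ ς₂ : ℝ≥0 → ℝ≥0} (h : IsIsoIso ε ς₁ ς₂) : IsIsoIso ε ς₂ ς₁ :=
  ⟨h.2.1, h.1, fun x y z hx hy hz => (h.2.2 x y z hx hy hz).symm⟩

theorem IsIsoIso.abs_sub_lt {ε : ℝ} (hε : 0 < ε) {ς₁ ς₂ : ℝ≥0 → ℝ≥0} (h : IsIsoIso ε ς₁ ς₂)
    {t : ℝ≥0} (ht : (t : ℝ) ≤ 1 / ε) : |(ς₁ t : ℝ) - t| < ε := by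
  have h0 : ((0 : ℝ≥0) : ℝ) ≤ 1 / ε := by simpa using hε.le
  -- Two arguments equal to zero reduce the second iso-iso inequality to a comparison of `t` with
  -- `ς₁ t`.
  have := (h.2.2 0 0 t h0 h0 ht).2
  rw [h.2.1] at this
  simp only [NNReal.coe_zero, add_zero, zero_sub, abs_neg, NNReal.abs_eq] at this
  rwa [abs_sub_comm] at this

/-! ### The graph norm and the unitary group -/

section GraphNorm

variable {X : Type*} [NormedAddCommGroup X] [InnerProductSpace ℂ X] {D : X →ₗ.[ℂ] X}

theorem graphNorm_of_mem {x : X} (h : x ∈ D.domain) : graphNorm D x = ‖x‖ₑ + ‖D ⟨x, h⟩‖ₑ :=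
  iInf_pos h

theorem graphNorm_le_one_iff {x : X} :
    graphNorm D x ≤ 1 ↔ ∃ h : x ∈ D.domain, ‖x‖ + ‖D ⟨x, h⟩‖ ≤ 1 := by
  have key : ∀ h : x ∈ D.domain, graphNorm D x ≤ 1 ↔ ‖x‖ + ‖D ⟨x, h⟩‖ ≤ 1 := by
    intro h
    rw [graphNorm_of_mem h, ← ofReal_norm, ← ofReal_norm,
      ← ENNReal.ofReal_add (norm_nonneg _) (norm_nonneg _), ENNReal.ofReal_le_one]
  constructor
  · intro hx
    have h : x ∈ D.domain := by
      by_contra h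
      rw [graphNorm, iInf_neg h] at hx
      exact absurd hx (by simp)
    exact ⟨h, (key h).1 hx⟩
  · rintro ⟨h, hx⟩
    exact (key h).2 hx

/-- The D-norms downstairs are infima over lifts; the factor `1/2` gives the strict inequality that
`exists_lift` needs for a lift in the unit ball. -/
theorem graphNorm_half_lt_one {x : X} (hx : graphNorm D x ≤ 1) :
    graphNorm D ((1 / 2 : ℂ) • x) < 1 := by
  obtain ⟨h, hx⟩ := graphNorm_le_one_iff.1 hx
  have e : (⟨(1 / 2 : ℂ) • x, D.domain.smul_mem _ h⟩ : D.domain) = (1 / 2 : ℂ) • ⟨x, h⟩ := rfl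
  rw [graphNorm_of_mem (D.domain.smul_mem _ h), e, D.map_smul, ← ofReal_norm, ← ofReal_norm,
    ← ENNReal.ofReal_add (norm_nonneg _) (norm_nonneg _), ENNReal.ofReal_lt_one, norm_smul,
    norm_smul]
  norm_num
  linarith

variable [CompleteSpace X]

/-- Combine `|exp(isr) - exp(itr)| ≤ |s - t| |r|` with `|r| ≤ (1 + r²)/2`, then sum by Parseval for
`x` and `D x`. -/
theorem norm_inner_expI_sub_le (hD : IsSelfAdjoint D) {R : X →L[ℂ] X}
    (hR : IsResolvent D (-Complex.I) R) (hc : IsCompactOperator R) {x : X}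
    (hx : graphNorm D x ≤ 1) (s t : ℝ) :
    ‖⟪expI D (-s) x, x⟫_ℂ - ⟪expI D (-t) x, x⟫_ℂ‖ ≤ |s - t| := by
  obtain ⟨h, hx⟩ := graphNorm_le_one_iff.1 hx
  have h1 := (hasSum_inner_expI_neg hD hR hc s x).sub (hasSum_inner_expI_neg hD hR hc t x)
  have h2 := hasSum_norm_sq_eigenProj hD hR hc x
  have h3 := hasSum_norm_sq_eigenProj hD hR hc (D ⟨x, h⟩)
  have h4 := (h2.add h3).mul_left (|s - t| / 2)
  have hn1 := norm_nonneg x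
  have hn2 := norm_nonneg (D ⟨x, h⟩)
  refine le_trans (h1.norm_le_of_bounded h4 fun r => ?_) ?_
  · rw [← sub_mul, norm_mul, Complex.norm_real, Real.norm_eq_abs, abs_of_nonneg (by positivity),
      eigenProj_map hD, norm_smul, Complex.norm_real, Real.norm_eq_abs, mul_pow, sq_abs]
    have h5 : ‖Complex.exp (Complex.I * s * r) - Complex.exp (Complex.I * t * r)‖
        ≤ |s - t| * |r| := by
      have e : Complex.exp (Complex.I * s * r) - Complex.exp (Complex.I * t * r) =
          Complex.exp (Complex.I * (t * r : ℝ)) *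
            (Complex.exp (Complex.I * ((s - t) * r : ℝ)) - 1) := by
        rw [mul_sub, ← Complex.exp_add, mul_one]
        congr 2
        · push_cast; ring
        · push_cast; ring
      rw [e, norm_mul, Complex.norm_exp_I_mul_ofReal, one_mul, ← abs_mul]
      exact Real.norm_exp_I_mul_ofReal_sub_one_le
    have h6 : |r| ≤ (1 + r ^ 2) / 2 := by nlinarith [sq_nonneg (|r| - 1), sq_abs r]
    calc _ ≤ |s - t| * ((1 + r ^ 2) / 2) * ‖eigenProj D r x‖ ^ 2 := by
          gcongr
          exact h5.trans (by gcongr)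
      _ = _ := by ring
  · have : ‖x‖ ^ 2 + ‖D ⟨x, h⟩‖ ^ 2 ≤ 2 := by nlinarith
    nlinarith [abs_nonneg (s - t)]

end GraphNorm

/-! ### Tunnels and spectra -/

theorem ModularQuantumIsometry.exists_lift {M N : Correspondence} (Q : ModularQuantumIsometry M N)
    {y : N.Mod} (hy : N.DN y < 1) : ∃ x : M.Mod, Q.onMod x = y ∧ M.DN x ≤ 1 := by
  rw [Q.quotient_DN y (hy.trans ENNReal.one_lt_top), iInf_lt_iff] at hy
  obtain ⟨x, hx⟩ := hy
  obtain ⟨h, hx⟩ := iInf_lt_iff.1 hx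
  exact ⟨x, h, hx.le⟩

theorem ModularQuantumIsometry.DN_le {M N : Correspondence} (Q : ModularQuantumIsometry M N)
    {x : M.Mod} (hx : M.DN x < ∞) : N.DN (Q.onMod x) ≤ M.DN x := by
  rw [Q.quotient_DN _ (Q.map_dom_DN x hx)]
  exact iInf₂_le (f := fun (p : M.Mod) (_ : Q.onMod p = Q.onMod x) => M.DN p) x rfl

section Propinquity

variable {F K G H : ℝ≥0}
  {A₁ X₁ A₂ X₂ : Type u}
  [CStarAlgebra A₁] [NormedAddCommGroup X₁] [InnerProductSpace ℂ X₁] [CompleteSpace X₁]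
  [CStarAlgebra A₂] [NormedAddCommGroup X₂] [InnerProductSpace ℂ X₂] [CompleteSpace X₂]
  {T₁ : SpectralTriple A₁ X₁} {T₂ : SpectralTriple A₂ X₂}

theorem exists_graphNorm_le_one_of_halfReach_lt {τ : Tunnel.{u, 0, u} F K G H T₁.corr T₂.corr}
    {ε : ℝ} {ς : ℝ≥0 → ℝ≥0} (h : halfReach T₁ T₂ τ ε ς < ENNReal.ofReal ε) {x : X₁}
    (hx : graphNorm T₁.D x ≤ 1) :
    ∃ y : X₂, graphNorm T₂.D y ≤ 1 ∧ ∀ t : ℝ≥0, (t : ℝ) ≤ 1 / ε → ∀ p : τ.mid.Mod,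
      τ.mid.DN p ≤ 1 → ‖⟪expI T₁.D (-(t : ℝ)) x, (τ.left.onMod p : X₁)⟫_ℂ -
        ⟪expI T₂.D (-(ς t : ℝ)) y, (τ.right.onMod p : X₂)⟫_ℂ‖ < ε := by
  have h1 := lt_of_le_of_lt (le_iSup₂_of_le (f := fun f
    (_ : f ∈ orbitFamilies T₁.D τ.left.onMod ε id) =>
      ⨅ g ∈ orbitFamilies T₂.D τ.right.onMod ε ς, kantorovichFamily τ.mid.DN f g)
    (fun t => (innerSL ℂ (expI T₁.D (-(id t.1 : ℝ≥0)) x)).comp τ.left.onMod)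
    ⟨x, hx, fun _ => rfl⟩ le_rfl) h
  obtain ⟨g, hg⟩ := iInf_lt_iff.1 h1
  obtain ⟨⟨y, hy, hgy⟩, hg⟩ := iInf_lt_iff.1 hg
  refine ⟨y, hy, fun t ht p hp => ?_⟩
  have h2 := lt_of_le_of_lt (le_iSup_of_le ⟨t, ht⟩ (le_iSup₂_of_le p hp le_rfl)) hg
  rw [hgy, ← ofReal_norm, ENNReal.ofReal_lt_ofReal_iff_of_nonneg (norm_nonneg _)] at h2
  exact h2

theorem exists_unit_eigenvector {X : Type*} [NormedAddCommGroup X] [InnerProductSpace ℂ X]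
    {D : X →ₗ.[ℂ] X} {l : ℝ} {e : X} (he : e ∈ eigenspace D l) (he0 : e ≠ 0) :
    ∃ x ∈ eigenspace D l, graphNorm D x ≤ 1 ∧ ‖x‖ = (1 + |l|)⁻¹ := by
  have hn : 0 < ‖e‖ := norm_pos_iff.2 he0
  set c : ℝ := (1 + |l|)⁻¹ * ‖e‖⁻¹ with hcdef
  have hx := (eigenspace D l).smul_mem (c : ℂ) he
  have hxn : ‖(c : ℂ) • e‖ = (1 + |l|)⁻¹ := by
    rw [norm_smul, Complex.norm_real, Real.norm_eq_abs, abs_of_nonneg (by positivity), hcdef,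
      mul_assoc, inv_mul_cancel₀ hn.ne', mul_one]
  refine ⟨_, hx, ?_, hxn⟩
  obtain ⟨h, h'⟩ := mem_eigenspace_iff.1 hx
  refine graphNorm_le_one_iff.2 ⟨h, le_of_eq ?_⟩
  rw [h', norm_smul (l : ℂ), hxn, Complex.norm_real, Real.norm_eq_abs]
  field_simp

/-- The heart of the proof. The constant `c` is a lower bound for `‖x‖² / 2`, where `x` is the
eigenvector of norm `(1 + |l|)⁻¹`. -/
theorem exists_mem_spectrum_of_halfReach_lt {τ : Tunnel.{u, 0, u} F K G H T₁.corr T₂.corr}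
    {ε : ℝ} (hε : 0 < ε) {ς : ℝ≥0 → ℝ≥0} (hς0 : ς 0 = 0)
    (hς : ∀ t : ℝ≥0, (t : ℝ) ≤ 1 / ε → |(ς t : ℝ) - t| < ε)
    (hreach : halfReach T₁ T₂ τ ε ς < ENNReal.ofReal ε) {l κ c : ℝ} (hκ : 0 < κ)
    (hl : (l : ℂ) ∈ spectrum T₁.D) (hcl : c * (2 * (1 + |l|) ^ 2) ≤ 1) (hεc : 2 * ε ≤ c)
    (hεκ : 4 * (ε * (5 + 2 / κ)) < c ^ 2) :
    ∃ r : ℝ, |r - l| < κ ∧ (r : ℂ) ∈ spectrum T₂.D := by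
  obtain ⟨R₁, hR₁, hc₁⟩ := T₁.compact_resolvent
  obtain ⟨R₂, hR₂, hc₂⟩ := T₂.compact_resolvent
  obtain ⟨l', hl', e, he, he0⟩ :=
    exists_mem_eigenspace_of_mem_spectrum T₁.selfAdjoint_D hR₁ hc₁ hl
  obtain rfl : l = l' := by exact_mod_cast hl'
  obtain ⟨x, hx, hx1, hxn⟩ := exists_unit_eigenvector he he0
  obtain ⟨y, hy1, hxy⟩ := exists_graphNorm_le_one_of_halfReach_lt hreach hx1
  have hxy' : ∀ t : ℝ≥0, (t : ℝ) ≤ 1 / ε → ∀ p : τ.mid.Mod, τ.mid.DN p ≤ 1 →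
      ‖Complex.exp (Complex.I * t * l) * ⟪x, (τ.left.onMod p : X₁)⟫_ℂ -
        ⟪expI T₂.D (-(ς t : ℝ)) y, (τ.right.onMod p : X₂)⟫_ℂ‖ < ε := by
    intro t ht p hp
    have := hxy t ht p hp
    rw [expI_of_mem_eigenspace T₁.selfAdjoint_D _ hx, inner_smul_left, ← Complex.exp_conj] at this
    simpa using this
  have h0 : ((0 : ℝ≥0) : ℝ) ≤ 1 / ε := by simpa using hε.le
  have hxy0 : ∀ p : τ.mid.Mod, τ.mid.DN p ≤ 1 →
      ‖⟪x, (τ.left.onMod p : X₁)⟫_ℂ - ⟪y, (τ.right.onMod p : X₂)⟫_ℂ‖ < ε := by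
    intro p hp
    have := hxy' 0 h0 p hp
    rw [hς0, NNReal.coe_zero, neg_zero, expI_zero T₂.selfAdjoint_D hR₂ hc₂] at this
    simpa using this
  -- At time zero on a lift of `x/2`: `‖x‖²/2 - ε ≤ ‖y‖`, and `ε ≤ c/2`.
  have hyn : c / 2 ≤ ‖y‖ := by
    obtain ⟨p, hp, hp1⟩ := τ.left.exists_lift (y := (1 / 2 : ℂ) • x) (graphNorm_half_lt_one hx1)
    have h1 := hxy0 p hp1
    have h2 : ‖(τ.right.onMod p : X₂)‖ ≤ 1 := by
      have h3 : graphNorm T₂.D (τ.right.onMod p : X₂) ≤ 1 :=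
        (τ.right.DN_le (hp1.trans_lt ENNReal.one_lt_top)).trans hp1
      obtain ⟨h4, h5⟩ := graphNorm_le_one_iff.1 h3
      linarith [norm_nonneg (T₂.D ⟨_, h4⟩)]
    have h3 : ‖⟪y, (τ.right.onMod p : X₂)⟫_ℂ‖ ≤ ‖y‖ :=
      (norm_inner_le_norm _ _).trans (mul_le_of_le_one_right (norm_nonneg _) h2)
    have h4 : ‖⟪x, (τ.left.onMod p : X₁)⟫_ℂ‖ = ((1 + |l|)⁻¹) ^ 2 / 2 := by
      rw [hp]
      rw [inner_smul_right, norm_mul, inner_self_eq_norm_sq_to_K, hxn, norm_pow]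
      have : 0 ≤ (1 + |l|)⁻¹ := by positivity
      rw [RCLike.norm_ofReal, abs_of_nonneg this]
      norm_num
      ring
    have h5 : c ≤ ((1 + |l|)⁻¹) ^ 2 / 2 := by
      rw [inv_pow, ← one_div, div_div, le_div_iff₀ (by positivity), mul_comm _ (2 : ℝ)]
      exact hcl
    have h6 := norm_sub_norm_le ⟪x, (τ.left.onMod p : X₁)⟫_ℂ ⟪y, (τ.right.onMod p : X₂)⟫_ℂ
    linarith
  by_contra! hgap
  have hs := hasSum_norm_sq_eigenProj T₂.selfAdjoint_D hR₂ hc₂ y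
  have key := mul_le_of_norm_sub_tsum_exp_le (l := l) (T := 1 / ε) (δ := 5 * ε)
    (fun r => by positivity) hs hκ (by positivity) ?_ ?_
  · have hy2 : ‖y‖ ≤ 1 := by
      obtain ⟨h4, h5⟩ := graphNorm_le_one_iff.1 hy1
      linarith [norm_nonneg (T₂.D ⟨_, h4⟩)]
    have h1 : ‖y‖ ^ 2 ≤ 1 := pow_le_one₀ (norm_nonneg _) hy2
    have h2 : (c / 2) ^ 2 ≤ ‖y‖ ^ 2 := pow_le_pow_left₀ (by linarith) hyn 2
    have h3 : ‖y‖ ^ 2 / κ ≤ 1 / κ := div_le_div_of_nonneg_right h1 hκ.le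
    have h4 : ‖y‖ ^ 2 ≤ ε * (5 + 2 / κ) := by
      have h5 : 1 / ε * ‖y‖ ^ 2 ≤ 5 + 2 / κ := by
        have : 5 * ε * (1 / ε) = 5 := by field_simp
        rw [this] at key
        have : 2 / κ = 2 * (1 / κ) := by ring
        linarith
      calc ‖y‖ ^ 2 = ε * (1 / ε * ‖y‖ ^ 2) := by field_simp
        _ ≤ _ := by gcongr
    -- Contradiction: `c²/4 ≤ ‖y‖² ≤ ε (5 + 2/κ) < c²/4`.
    nlinarith
  · intro r hr
    by_contra! hlt
    obtain ⟨e, he, he0⟩ := exists_mem_eigenspace_of_eigenProj_ne_zero (D := T₂.D) (r := r) (x := y)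
      (by rintro h; simp [h] at hr)
    exact hgap r hlt (ofReal_mem_spectrum_of_mem_eigenspace he he0)
  · intro t ht0 htT
    lift t to ℝ≥0 using ht0
    rw [(hasSum_inner_expI_neg T₂.selfAdjoint_D hR₂ hc₂ t y).tsum_eq]
    obtain ⟨p, hp, hp1⟩ := τ.right.exists_lift (y := (1 / 2 : ℂ) • y) (graphNorm_half_lt_one hy1)
    have h1 := hxy' t htT p hp1
    have h2 := hxy0 p hp1
    rw [hp] at h1 h2
    change ‖_ - ⟪_, (1 / 2 : ℂ) • y⟫_ℂ‖ < ε at h1 h2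
    rw [inner_smul_right] at h1 h2
    have h3 := norm_inner_expI_sub_le T₂.selfAdjoint_D hR₂ hc₂ hy1 (ς t) t
    have h4 := hς t htT
    rw [inner_self_eq_norm_sq_to_K] at h2
    set a := ⟪x, (τ.left.onMod p : X₁)⟫_ℂ
    set b := ⟪expI T₂.D (-(ς t : ℝ)) y, y⟫_ℂ
    set d := ⟪expI T₂.D (-(t : ℝ)) y, y⟫_ℂ
    set E := Complex.exp (Complex.I * ((t : ℝ) : ℂ) * l) with hE
    have hEn : ‖E‖ = 1 := by
      rw [hE, mul_assoc, ← Complex.ofReal_mul, Complex.norm_exp_I_mul_ofReal]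
    -- The error `5ε`: `2ε` from time zero and `2ε` from time `t`, doubled by the lift of `y/2`, and
    -- `ε` from replacing `ς t` by `t`.
    have e : E * ((‖y‖ ^ 2 : ℝ) : ℂ) - d = (-2) * (E * (a - 1 / 2 * (‖y‖ : ℂ) ^ 2)) +
        2 * (E * a - 1 / 2 * b) + (b - d) := by
      push_cast; ring
    rw [e]
    refine (norm_add₃_le).trans ?_
    rw [norm_mul, norm_mul, norm_mul, hEn, norm_neg, Complex.norm_ofNat, one_mul]
    have h2' : ‖a - 1 / 2 * (‖y‖ : ℂ) ^ 2‖ < ε := h2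
    linarith

theorem exists_tunnel_of_spectralPropinquity_lt {δ : ℝ} (hδ : δ ≤ √2 / 2)
    (h : spectralPropinquity F K G H T₁ T₂ < δ) :
    ∃ ε : ℝ, 0 < ε ∧ ε < δ ∧ ∃ τ : Tunnel.{u, 0, u} F K G H T₁.corr T₂.corr,
      ∃ ς₁ ς₂ : ℝ≥0 → ℝ≥0, IsIsoIso ε ς₁ ς₂ ∧
        halfReach T₁ T₂ τ ε ς₁ < ENNReal.ofReal ε ∧
        halfReach T₂ T₁ τ.symm ε ς₂ < ENNReal.ofReal ε := by
  obtain ⟨ε, hε, hεδ⟩ := exists_lt_of_csInf_lt ⟨√2 / 2, Or.inl rfl⟩ h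
  rcases hε with rfl | ⟨h0, τ, ς₁, ς₂, hi, hm⟩
  -- The bound on `δ` excludes the default value `√2 / 2`.
  · exact absurd hεδ (not_lt.2 hδ)
  · have := max_lt_iff.1 (max_lt_iff.1 hm).2
    exact ⟨ε, h0, hεδ, τ, ς₁, ς₂, hi, this.1, this.2⟩

theorem exists_mem_spectrum_of_spectralPropinquity_lt {δ κ c l : ℝ} (hδ : δ ≤ √2 / 2)
    (h : spectralPropinquity F K G H T₁ T₂ < δ) (hκ : 0 < κ)
    (hcl : c * (2 * (1 + |l|) ^ 2) ≤ 1) (hδc : 2 * δ ≤ c) (hδκ : 4 * (δ * (5 + 2 / κ)) < c ^ 2) :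
    ((l : ℂ) ∈ spectrum T₁.D → ∃ r : ℝ, |r - l| < κ ∧ (r : ℂ) ∈ spectrum T₂.D) ∧
      ((l : ℂ) ∈ spectrum T₂.D → ∃ r : ℝ, |r - l| < κ ∧ (r : ℂ) ∈ spectrum T₁.D) := by
  obtain ⟨ε, hε, hεδ, τ, ς₁, ς₂, hi, h1, h2⟩ := exists_tunnel_of_spectralPropinquity_lt hδ h
  have hεκ : 4 * (ε * (5 + 2 / κ)) < c ^ 2 := lt_of_le_of_lt (by gcongr) hδκ
  exact ⟨fun hl => exists_mem_spectrum_of_halfReach_lt hε hi.1 (fun t ht => hi.abs_sub_lt hε ht)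
      h1 hκ hl hcl (by linarith) hεκ,
    fun hl => exists_mem_spectrum_of_halfReach_lt hε hi.2.1
      (fun t ht => hi.symm.abs_sub_lt hε ht) h2 hκ hl hcl (by linarith) hεκ⟩

/-- One threshold serves all `|l| ≤ M`, as is needed when `l` varies with `n`. The `8` in place of
`4` makes the last inequality strict. -/
theorem exists_propinquity_bound {κ M : ℝ} (hκ : 0 < κ) (hM : 0 ≤ M) :
    ∃ δ c : ℝ, 0 < δ ∧ δ ≤ √2 / 2 ∧ c * (2 * (1 + M) ^ 2) ≤ 1 ∧ 0 < c ∧ 2 * δ ≤ c ∧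
      4 * (δ * (5 + 2 / κ)) < c ^ 2 := by
  set c : ℝ := (2 * (1 + M) ^ 2)⁻¹ with hc
  have hc0 : 0 < c := by positivity
  have hq : 0 < 5 + 2 / κ := by positivity
  refine ⟨min (√2 / 2) (min (c / 2) (c ^ 2 / (8 * (5 + 2 / κ)))), c, ?_, min_le_left _ _, ?_, hc0,
    ?_, ?_⟩
  · have : 0 < √2 := by positivity
    positivity
  · rw [hc, inv_mul_cancel₀ (by positivity)]
  · have := (min_le_right (√2 / 2) (min (c / 2) (c ^ 2 / (8 * (5 + 2 / κ))))).trans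
      (min_le_left _ _)
    linarith
  · have h1 := (min_le_right (√2 / 2) (min (c / 2) (c ^ 2 / (8 * (5 + 2 / κ))))).trans
      (min_le_right _ _)
    have h2 := mul_le_mul_of_nonneg_right h1 hq.le
    have h3 : c ^ 2 / (8 * (5 + 2 / κ)) * (5 + 2 / κ) = c ^ 2 / 8 := by field_simp
    have : 0 < c ^ 2 := by positivity
    linarith

end Propinquity

end SpectralPropinquity

/-! ### Convergence of the spectra -/

theorem mainTheorem1 (F K G H : NNReal) (hF : 1 ≤ F) (hG : 1 ≤ G) (hH : 2 ≤ H)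
    {A X : ℕ → Type u} [∀ n, CStarAlgebra (A n)] [∀ n, NormedAddCommGroup (X n)]
    [∀ n, InnerProductSpace ℂ (X n)] [∀ n, CompleteSpace (X n)] [∀ n, Nontrivial (X n)]
    {Alim Xlim : Type u} [CStarAlgebra Alim] [NormedAddCommGroup Xlim]
    [InnerProductSpace ℂ Xlim] [CompleteSpace Xlim]
    (T : ∀ n, SpectralPropinquity.SpectralTriple (A n) (X n))
    (Tlim : SpectralPropinquity.SpectralTriple Alim Xlim)
    (hT : ∀ n, (T n).IsMetric) (hTlim : Tlim.IsMetric)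
    (hconv : Tendsto (fun n => SpectralPropinquity.spectralPropinquity F K G H (T n) Tlim)
      atTop (𝓝 0)) :
    SpectralPropinquity.spectrum Tlim.D =
      {z : ℂ | ∃ r : ℝ, z = r ∧ ∃ l : ℕ → ℝ,
        (∀ n, (l n : ℂ) ∈ SpectralPropinquity.spectrum (T n).D) ∧
        Tendsto l atTop (𝓝 r)} := by
  obtain ⟨R, hR, hc⟩ := Tlim.compact_resolvent
  ext z
  constructor
  · intro hz
    obtain ⟨r, rfl, -⟩ :=
      SpectralPropinquity.exists_mem_eigenspace_of_mem_spectrum Tlim.selfAdjoint_D hR hc hz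
    refine ⟨r, rfl, ?_⟩
    have hne : ∀ n, {s : ℝ | (s : ℂ) ∈ SpectralPropinquity.spectrum (T n).D}.Nonempty := by
      intro n
      obtain ⟨Rn, hRn, hcn⟩ := (T n).compact_resolvent
      exact SpectralPropinquity.nonempty_spectrum (T n).selfAdjoint_D hRn hcn
    -- Almost nearest points of the spectra, with slack `1 / (n + 1)`; it remains to see that the
    -- distances from `r` to the spectra tend to zero.
    have hnear : ∀ n : ℕ, ∃ s : ℝ, (s : ℂ) ∈ SpectralPropinquity.spectrum (T n).D ∧
        |s - r| < Metric.infDist r {s : ℝ | (s : ℂ) ∈ SpectralPropinquity.spectrum (T n).D} +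
          1 / (n + 1) := by
      intro n
      obtain ⟨s, hs, hs'⟩ := (Metric.infDist_lt_iff (hne n)).1
        (lt_add_of_pos_right (Metric.infDist r _) (Nat.one_div_pos_of_nat (α := ℝ) (n := n)))
      exact ⟨s, hs, by rwa [dist_comm, Real.dist_eq] at hs'⟩
    choose l hl hl' using hnear
    refine ⟨l, hl, ?_⟩
    have hinf : Tendsto (fun n => Metric.infDist r
        {s : ℝ | (s : ℂ) ∈ SpectralPropinquity.spectrum (T n).D}) atTop (𝓝 0) := by
      rw [Metric.tendsto_atTop']
      intro κ hκ
      obtain ⟨δ, c, hδ0, hδ, hcl, -, hδc, hδκ⟩ :=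
        SpectralPropinquity.exists_propinquity_bound hκ (abs_nonneg r)
      obtain ⟨N, hN⟩ := eventually_atTop.1 (hconv.eventually_lt_const hδ0)
      refine ⟨N, fun n hn => ?_⟩
      obtain ⟨s, hs, hs'⟩ := (SpectralPropinquity.exists_mem_spectrum_of_spectralPropinquity_lt
        hδ (hN n hn.le) hκ hcl hδc hδκ).2 hz
      rw [Real.dist_eq, sub_zero, abs_of_nonneg Metric.infDist_nonneg]
      refine lt_of_le_of_lt (Metric.infDist_le_dist_of_mem hs') ?_
      rwa [dist_comm, Real.dist_eq]
    rw [tendsto_iff_dist_tendsto_zero]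
    refine squeeze_zero (fun n => dist_nonneg) (fun n => (hl' n).le) ?_
    simpa using hinf.add tendsto_one_div_add_atTop_nhds_zero_nat
  · rintro ⟨r, rfl, l, hl, hlr⟩
    refine SpectralPropinquity.mem_spectrum_of_tendsto Tlim.selfAdjoint_D hR hc fun κ hκ => ?_
    obtain ⟨δ, c, hδ0, hδ, hcl, hc0, hδc, hδκ⟩ :=
      SpectralPropinquity.exists_propinquity_bound (half_pos hκ) (M := |r| + 1) (by positivity)
    have hev := (hconv.eventually_lt_const hδ0).and
      (hlr.eventually (Metric.ball_mem_nhds r (lt_min (half_pos hκ) one_pos)))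
    -- A single `n` suffices for each `κ`: half of `κ` is spent from `r` to `l n`, half from `l n`
    -- to the limit spectrum.
    obtain ⟨n, hn, hn'⟩ := hev.exists
    rw [Real.dist_eq, lt_min_iff] at hn'
    have hln : |l n| ≤ |r| + 1 := by
      have := abs_sub_abs_le_abs_sub (l n) r
      linarith [hn'.2]
    obtain ⟨s, hs, hs'⟩ := (SpectralPropinquity.exists_mem_spectrum_of_spectralPropinquity_lt
      hδ hn (half_pos hκ) (le_trans (by gcongr) hcl) hδc hδκ).1 (hl n)
    refine ⟨s, ?_, hs'⟩
    have := abs_sub_le s (l n) r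
    linarith [hn'.1]
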